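/- **Theorem ($p$-adic interpolation lemma).** Let $k$ be a field of characteristic $0$ which is complete with respect to a non-archimedean absolute value $|\cdot|$, and let $\tilde k$ be its residue field. Put $R(k):=1$ if $\operatorname{char}\tilde k=0$ and $R(k):=|p|^{1/(p-1)}$ if $\operatorname{char}\tilde k=p>0$ (so $R(k)=p^{-1/(p-1)}$ when the absolute value is normalized by $|p|=p^{-1}$). Let $A$ be a $k$-affinoid algebra with Banach norm $\|\cdot\|$, let $f:\mathcal M(A)\to\mathcal M(A)$ be the endomorphism of the $k$-affinoid space $\mathcal M(A)$ given by a bounded $k$-algebra endomorphism $f^*:A\to A$, let $\Delta_f:=f^*-\mathrm{id}$ and let $\rho(\Delta_f)=\lim_{n}\|\Delta_f^n\|^{1/n}$ be the spectral radius of the bounded operator $\Delta_f$ on $A$. Let $\mathbb D:=\mathcal M(k\{T\})$ be the closed unit disc with the group structure given by addition. If $\rho(\Delta_f)<R(k)$, then there is a unique action of the group $(\mathbb D,+)$ on $\mathcal M(A)$ which extends the action of $\mathbb Z_{\ge0}$ by iterates of $f$; that is, a unique morphism of $k$-affinoid spaces $\Phi:\mathbb D\times\mathcal M(A)\to\mathcal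 M(A)$ such that $\Phi(0,x)=x$, $\Phi(s+t,x)=\Phi(s,\Phi(t,x))$ (as identities of morphisms of $k$-affinoid spaces) and $\Phi(n,\cdot)=f^n$ for every $n\in\mathbb Z_{\ge0}\subseteq\mathbb D(k)$. -/

import Mathlib

open Filter Topology TensorProduct

noncomputable section

namespace Berk

/-! ### Bounded homomorphisms -/

/-- A bounded homomorphism of Banach `k`-algebras. By definition, a morphism of `k`-affinoid
spaces `M(B) → M(A)` is (the map induced by) a bounded homomorphism `A → B`. -/
structure BddHom (k A B : Type*) [NormedField k] [NormedCommRing A] [NormedAlgebra k A]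
    [NormedCommRing B] [NormedAlgebra k B] extends A →ₐ[k] B where
  bounded' : ∃ C : ℝ, ∀ x, ‖toFun x‖ ≤ C * ‖x‖

section BddHom

variable {k A B C : Type*} [NormedField k] [NormedCommRing A] [NormedAlgebra k A]
  [NormedCommRing B] [NormedAlgebra k B] [NormedCommRing C] [NormedAlgebra k C]

instance : FunLike (BddHom k A B) A B where
  coe f := f.toAlgHom
  coe_injective := by
    rintro ⟨f, hf⟩ ⟨g, hg⟩ h
    have : f = g := DFunLike.coe_injective h
    subst this
    rfl

theorem BddHom.bounded (f : BddHom k A B) : ∃ C : ℝ, 0 ≤ C ∧ ∀ x, ‖f x‖ ≤ C * ‖x‖ := by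
  obtain ⟨C, hC⟩ := f.bounded'
  refine ⟨max C 0, le_max_right _ _, fun x => (hC x).trans ?_⟩
  gcongr
  exact le_max_left _ _

/-- The identity. -/
def BddHom.id (k A : Type*) [NormedField k] [NormedCommRing A] [NormedAlgebra k A] :
    BddHom k A A where
  toAlgHom := AlgHom.id k A
  bounded' := ⟨1, fun x => by simp⟩

/-- Composition. -/
def BddHom.comp (g : BddHom k B C) (f : BddHom k A B) : BddHom k A C where
  toAlgHom := g.toAlgHom.comp f.toAlgHom
  bounded' := by
    obtain ⟨c, hc, h⟩ := f.bounded
    obtain ⟨d, hd, h'⟩ := g.bounded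
    refine ⟨d * c, fun x => ?_⟩
    calc ‖g (f x)‖ ≤ d * ‖f x‖ := h' _
      _ ≤ d * (c * ‖x‖) := by gcongr; exact h x
      _ = d * c * ‖x‖ := by ring

/-- The structure homomorphism `k → A`. -/
def BddHom.structureMap (k A : Type*) [NormedField k] [NormedCommRing A] [NormedAlgebra k A] :
    BddHom k k A where
  toAlgHom := Algebra.ofId k A
  bounded' := ⟨‖(1 : A)‖, fun x => by
    change ‖algebraMap k A x‖ ≤ _
    rw [norm_algebraMap, mul_comm]⟩

end BddHom

/-! ### The algebras `k{r⁻¹T}` -/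

/-- The algebra `k{r₁⁻¹T₁, …, rₙ⁻¹Tₙ}` of power series `∑ aᵥ Tᵛ` with `|aᵥ| rᵛ → 0`. -/
def Tate (k : Type*) [NormedField k] [IsUltrametricDist k] {σ : Type*}
    (r : σ → {x : ℝ // 0 < x}) : Type _ :=
  MvPowerSeries.IsRestricted.subring (R := k) (fun i => (r i : ℝ))

namespace Tate

variable {k : Type*} [NormedField k] [IsUltrametricDist k] {σ : Type*}
  (r : σ → {x : ℝ // 0 < x})

instance : CommRing (Tate k r) :=
  inferInstanceAs (CommRing (MvPowerSeries.IsRestricted.subring (R := k) (fun i => (r i : ℝ))))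

variable {r}

/-- The coefficient of `Tᵛ`. -/
def coeff (v : σ →₀ ℕ) (f : Tate k r) : k := MvPowerSeries.coeff v f.1

theorem ext {f g : Tate k r} (h : ∀ v, coeff v f = coeff v g) : f = g :=
  Subtype.ext (MvPowerSeries.ext h)

theorem coeff_add (v : σ →₀ ℕ) (f g : Tate k r) : coeff v (f + g) = coeff v f + coeff v g :=
  map_add (MvPowerSeries.coeff v) f.1 g.1

theorem coeff_mul [DecidableEq σ] (v : σ →₀ ℕ) (f g : Tate k r) :
    coeff v (f * g) = ∑ p ∈ Finset.HasAntidiagonal.antidiagonal v, coeff p.1 f * coeff p.2 g :=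
  MvPowerSeries.coeff_mul v f.1 g.1

theorem tendsto_coeff (f : Tate k r) :
    Tendsto (fun v => ‖coeff v f‖ * v.prod (fun i n => (r i : ℝ) ^ n)) cofinite (𝓝 0) :=
  f.2

theorem hasGaussNorm (f : Tate k r) :
    MvPowerSeries.HasGaussNorm (fun a : k => ‖a‖) (fun i => (r i : ℝ)) f.1 := by
  have h := (tendsto_coeff f)
  have h1 : ∀ᶠ v in cofinite, ‖coeff v f‖ * v.prod (fun i n => (r i : ℝ) ^ n) ≤ 1 :=
    (h.eventually (gt_mem_nhds one_pos)).mono fun _ hx => hx.le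
  have hfin := (Filter.eventually_cofinite.mp h1)
  obtain ⟨M, hM⟩ := (hfin.image
    (fun v => ‖coeff v f‖ * v.prod (fun i n => (r i : ℝ) ^ n))).bddAbove
  refine ⟨max M 1, ?_⟩
  rintro _ ⟨v, rfl⟩
  by_cases hv : ‖coeff v f‖ * v.prod (fun i n => (r i : ℝ) ^ n) ≤ 1
  · exact hv.trans (le_max_right _ _)
  · exact (hM ⟨v, hv, rfl⟩).trans (le_max_left _ _)

/-- The constants `k → k{r⁻¹T}`. -/
def C (r : σ → {x : ℝ // 0 < x}) : k →+* Tate k r :=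
  (MvPowerSeries.C (σ := σ) (R := k)).codRestrict
    (MvPowerSeries.IsRestricted.subring (R := k) (fun i => (r i : ℝ)))
    (fun a => MvPowerSeries.isRestricted_C _ a)

instance : Algebra k (Tate k r) := (C r).toAlgebra

theorem coeff_smul (v : σ →₀ ℕ) (a : k) (f : Tate k r) : coeff v (a • f) = a * coeff v f := by
  rw [Algebra.smul_def]
  exact MvPowerSeries.coeff_C_mul v f.1 a

theorem prod_nonneg (v : σ →₀ ℕ) : 0 ≤ v.prod (fun i n => (r i : ℝ) ^ n) :=
  Finset.prod_nonneg fun i _ => pow_nonneg (r i).2.le _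

/-- The Gauss norm `‖∑ aᵥ Tᵛ‖ = sup |aᵥ| rᵛ`. -/
instance : NormedCommRing (Tate k r) where
  __ := (inferInstance : CommRing (Tate k r))
  __ := AddGroupNorm.toNormedAddCommGroup (E := Tate k r)
    { toFun := fun f => MvPowerSeries.gaussNorm (fun a : k => ‖a‖) (fun i => (r i : ℝ)) f.1
      map_zero' := MvPowerSeries.gaussNorm_zero _ _ norm_zero
      add_le' := fun f g =>
        (MvPowerSeries.gaussNorm_add_le_max _ _ f.1 g.1 (fun i => (r i).2.le) norm_nonneg
          IsUltrametricDist.isNonarchimedean_norm (hasGaussNorm f) (hasGaussNorm g)).trans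
          (max_le_add_of_nonneg (MvPowerSeries.gaussNorm_nonneg _ _ _ norm_nonneg)
            (MvPowerSeries.gaussNorm_nonneg _ _ _ norm_nonneg))
      neg' := fun f => MvPowerSeries.gaussNorm_neg _ _ norm_neg f.1
      eq_zero_of_map_eq_zero' := fun f hf => Subtype.ext
        ((MvPowerSeries.gaussNorm_eq_zero_iff _ _ f.1 norm_zero norm_nonneg
          (fun _ => norm_eq_zero.mp) (fun i => (r i).2) (hasGaussNorm f)).mp hf) }
  norm_mul_le := fun f g =>
    MvPowerSeries.gaussNorm_mul_le _ _ f.1 g.1 (fun i => (r i).2.le) norm_nonneg norm_mul_le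
      IsUltrametricDist.isNonarchimedean_norm norm_zero (hasGaussNorm f) (hasGaussNorm g)

theorem norm_eq (f : Tate k r) :
    ‖f‖ = ⨆ v : σ →₀ ℕ, ‖coeff v f‖ * v.prod (fun i n => (r i : ℝ) ^ n) := rfl

theorem le_norm (f : Tate k r) (v : σ →₀ ℕ) :
    ‖coeff v f‖ * v.prod (fun i n => (r i : ℝ) ^ n) ≤ ‖f‖ :=
  le_ciSup (hasGaussNorm f) v

instance : NormedAlgebra k (Tate k r) where
  __ := (inferInstance : Algebra k (Tate k r))
  norm_smul_le := fun a f => by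
    rw [norm_eq]
    refine Real.iSup_le (fun v => ?_) (by positivity)
    rw [coeff_smul, norm_mul, mul_assoc]
    gcongr
    exact le_norm f v

instance : IsUltrametricDist (Tate k r) :=
  IsUltrametricDist.isUltrametricDist_of_forall_norm_add_le_max_norm fun f g =>
    MvPowerSeries.gaussNorm_add_le_max _ _ f.1 g.1 (fun i => (r i).2.le) norm_nonneg
      IsUltrametricDist.isNonarchimedean_norm (hasGaussNorm f) (hasGaussNorm g)

end Tate

/-- A Banach `k`-algebra `A` is `k`-affinoid if there is an admissible epimorphism
`k{r₁⁻¹T₁, …, rₙ⁻¹Tₙ} → A`: a bounded surjective homomorphism such that the norm of `A` is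
equivalent to the quotient norm. -/
def IsAffinoid (k A : Type*) [NormedField k] [IsUltrametricDist k]
    [NormedCommRing A] [NormedAlgebra k A] : Prop :=
  ∃ (n : ℕ) (r : Fin n → {x : ℝ // 0 < x}) (π : BddHom k (Tate k r) A) (C : ℝ),
    ∀ a : A, ∃ g : Tate k r, π g = a ∧ ‖g‖ ≤ C * ‖a‖

/-! ### Completed tensor products -/

/-- The algebraic tensor product `A ⊗ B`, to be endowed with its tensor product seminorm. -/
def PreTensor (k A B : Type*) [NormedField k] [NormedCommRing A] [NormedAlgebra k A]
    [NormedCommRing B] [NormedAlgebra k B] : Type _ := A ⊗[k] B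

section PreTensor

variable (k A B : Type*) [NormedField k] [NormedCommRing A] [NormedAlgebra k A]
    [NormedCommRing B] [NormedAlgebra k B]

instance : CommRing (PreTensor k A B) := inferInstanceAs (CommRing (A ⊗[k] B))

instance : Algebra k (PreTensor k A B) := inferInstanceAs (Algebra k (A ⊗[k] B))

variable {k A B}

/-- `a ⊗ b`. -/
def PreTensor.tmul (a : A) (b : B) : PreTensor k A B := a ⊗ₜ[k] b

/-- The finite sums `∑ aᵢ ⊗ bᵢ` with `‖aᵢ‖ ‖bᵢ‖ ≤ c` for all `i`. -/
def PreTensor.sums (c : ℝ) : AddSubmonoid (PreTensor k A B) :=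
  AddSubmonoid.closure {x | ∃ a b, ‖a‖ * ‖b‖ ≤ c ∧ x = PreTensor.tmul a b}

/-- The tensor product seminorm: the infimum of `max ‖aᵢ‖ ‖bᵢ‖` over all the representations
`x = ∑ aᵢ ⊗ bᵢ`. -/
def PreTensor.seminorm (x : PreTensor k A B) : ℝ :=
  sInf {c : ℝ | 0 ≤ c ∧ x ∈ PreTensor.sums c}

namespace PreTensor

theorem sums_mono {c d : ℝ} (h : c ≤ d) : sums (k := k) (A := A) (B := B) c ≤ sums d :=
  AddSubmonoid.closure_mono fun _ ⟨a, b, hab, hx⟩ => ⟨a, b, hab.trans h, hx⟩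

theorem seminorm_nonneg (x : PreTensor k A B) : 0 ≤ seminorm x :=
  Real.sInf_nonneg fun _ h => h.1

theorem seminorm_le {x : PreTensor k A B} {c : ℝ} (hc : 0 ≤ c) (h : x ∈ sums c) :
    seminorm x ≤ c :=
  csInf_le ⟨0, fun _ h => h.1⟩ ⟨hc, h⟩

theorem exists_mem_sums (x : PreTensor k A B) : ∃ c, 0 ≤ c ∧ x ∈ sums c := by
  induction x using TensorProduct.induction_on with
  | zero => exact ⟨0, le_rfl, zero_mem _⟩
  | tmul a b =>
    exact ⟨‖a‖ * ‖b‖, by positivity, AddSubmonoid.subset_closure ⟨a, b, le_rfl, rfl⟩⟩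
  | add x y hx hy =>
    obtain ⟨c, hc, hx⟩ := hx
    obtain ⟨d, hd, hy⟩ := hy
    exact ⟨max c d, le_max_of_le_left hc,
      add_mem (sums_mono (le_max_left _ _) hx) (sums_mono (le_max_right _ _) hy)⟩

theorem mem_sums_of_lt {x : PreTensor k A B} {c : ℝ} (h : seminorm x < c) : x ∈ sums c := by
  obtain ⟨d, ⟨_, hd⟩, hdc⟩ := exists_lt_of_csInf_lt (exists_mem_sums x) h
  exact sums_mono hdc.le hd

theorem mul_mem_sums {x y : PreTensor k A B} {c d : ℝ}
    (hx : x ∈ sums c) (hy : y ∈ sums d) : x * y ∈ sums (c * d) := by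
  induction hx using AddSubmonoid.closure_induction with
  | zero => rw [zero_mul]; exact zero_mem _
  | add x x' _ _ hx hx' => rw [add_mul]; exact add_mem hx hx'
  | mem x hx =>
    obtain ⟨a, b, hab, rfl⟩ := hx
    induction hy using AddSubmonoid.closure_induction with
    | zero => rw [mul_zero]; exact zero_mem _
    | add x x' _ _ hx hx' => rw [mul_add]; exact add_mem hx hx'
    | mem y hy =>
      obtain ⟨a', b', hab', rfl⟩ := hy
      refine AddSubmonoid.subset_closure ⟨a * a', b * b', ?_,
        Algebra.TensorProduct.tmul_mul_tmul a a' b b'⟩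
      calc ‖a * a'‖ * ‖b * b'‖ ≤ (‖a‖ * ‖a'‖) * (‖b‖ * ‖b'‖) := by
            gcongr <;> exact norm_mul_le _ _
        _ = (‖a‖ * ‖b‖) * (‖a'‖ * ‖b'‖) := by ring
        _ ≤ c * d := by
          have : 0 ≤ c := le_trans (by positivity) hab
          gcongr

theorem neg_mem_sums {x : PreTensor k A B} {c : ℝ} (hx : x ∈ sums c) : -x ∈ sums c := by
  induction hx using AddSubmonoid.closure_induction with
  | zero => rw [neg_zero]; exact zero_mem _
  | add x x' _ _ hx hx' => rw [neg_add]; exact add_mem hx hx'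
  | mem x hx =>
    obtain ⟨a, b, hab, rfl⟩ := hx
    exact AddSubmonoid.subset_closure
      ⟨-a, b, by rwa [norm_neg], (TensorProduct.neg_tmul (R := k) a b).symm⟩

theorem seminorm_add_le_max (x y : PreTensor k A B) :
    seminorm (x + y) ≤ max (seminorm x) (seminorm y) := by
  refine le_of_forall_gt_imp_ge_of_dense fun c hc => ?_
  exact seminorm_le ((seminorm_nonneg x).trans ((le_max_left _ _).trans hc.le))
    (add_mem (mem_sums_of_lt ((le_max_left _ _).trans_lt hc))
      (mem_sums_of_lt ((le_max_right _ _).trans_lt hc)))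

theorem seminorm_mul_le (x y : PreTensor k A B) :
    seminorm (x * y) ≤ seminorm x * seminorm y := by
  have key : ∀ ε > 0, seminorm (x * y) ≤ (seminorm x + ε) * (seminorm y + ε) := fun ε hε => by
    have hx := seminorm_nonneg x
    have hy := seminorm_nonneg y
    exact seminorm_le (by positivity) (mul_mem_sums
      (mem_sums_of_lt (by linarith)) (mem_sums_of_lt (by linarith)))
  have ht : Tendsto (fun ε : ℝ => (seminorm x + ε) * (seminorm y + ε)) (𝓝[>] 0)
      (𝓝 ((seminorm x + 0) * (seminorm y + 0))) :=
    tendsto_nhdsWithin_of_tendsto_nhds (Continuous.tendsto (by fun_prop) 0)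
  rw [add_zero, add_zero] at ht
  exact ge_of_tendsto ht (eventually_mem_nhdsWithin.mono key)

theorem seminorm_neg_le (x : PreTensor k A B) : seminorm (-x) ≤ seminorm x := by
  refine le_of_forall_gt_imp_ge_of_dense fun c hc => ?_
  exact seminorm_le ((seminorm_nonneg x).trans hc.le) (neg_mem_sums (mem_sums_of_lt hc))

/-- The tensor product seminorm as a ring seminorm. -/
def ringSeminorm (k A B : Type*) [NormedField k] [NormedCommRing A] [NormedAlgebra k A]
    [NormedCommRing B] [NormedAlgebra k B] : RingSeminorm (PreTensor k A B) where
  toFun := seminorm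
  map_zero' := le_antisymm (seminorm_le le_rfl (zero_mem _)) (seminorm_nonneg _)
  add_le' := fun x y => (seminorm_add_le_max x y).trans
    (max_le_add_of_nonneg (seminorm_nonneg _) (seminorm_nonneg _))
  neg' := fun x => le_antisymm (seminorm_neg_le x) (by simpa using seminorm_neg_le (-x))
  mul_le' := seminorm_mul_le

instance : SeminormedCommRing (PreTensor k A B) where
  __ := (ringSeminorm k A B).toSeminormedRing
  mul_comm := mul_comm

theorem norm_eq (x : PreTensor k A B) : ‖x‖ = seminorm x := rfl

theorem norm_tmul_le (a : A) (b : B) : ‖(tmul a b : PreTensor k A B)‖ ≤ ‖a‖ * ‖b‖ :=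
  seminorm_le (by positivity) (AddSubmonoid.subset_closure ⟨a, b, le_rfl, rfl⟩)

theorem smul_mem_sums {x : PreTensor k A B} {c : ℝ} (t : k) (hx : x ∈ sums c) :
    t • x ∈ sums (‖t‖ * c) := by
  induction hx using AddSubmonoid.closure_induction with
  | zero => rw [smul_zero]; exact zero_mem _
  | add x x' _ _ hx hx' => rw [smul_add]; exact add_mem hx hx'
  | mem x hx =>
    obtain ⟨a, b, hab, rfl⟩ := hx
    refine AddSubmonoid.subset_closure
      ⟨t • a, b, ?_, TensorProduct.smul_tmul' (R := k) t a b⟩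
    calc ‖t • a‖ * ‖b‖ ≤ (‖t‖ * ‖a‖) * ‖b‖ := by gcongr; exact norm_smul_le _ _
      _ = ‖t‖ * (‖a‖ * ‖b‖) := by ring
      _ ≤ ‖t‖ * c := by gcongr

instance : NormedAlgebra k (PreTensor k A B) where
  __ := (inferInstance : Algebra k (PreTensor k A B))
  norm_smul_le := fun t x => by
    have key : ∀ ε > 0, seminorm (t • x) ≤ ‖t‖ * (seminorm x + ε) := fun ε hε => by
      have hx := seminorm_nonneg x
      exact seminorm_le (by positivity) (smul_mem_sums t (mem_sums_of_lt (by linarith)))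
    have ht : Tendsto (fun ε : ℝ => ‖t‖ * (seminorm x + ε)) (𝓝[>] 0)
        (𝓝 (‖t‖ * (seminorm x + 0))) :=
      tendsto_nhdsWithin_of_tendsto_nhds (Continuous.tendsto (by fun_prop) 0)
    rw [add_zero] at ht
    exact ge_of_tendsto ht (eventually_mem_nhdsWithin.mono key)

end PreTensor

/-- The completed tensor product `A ⊗̂ B`. The product of the `k`-affinoid spaces `M(A)` and
`M(B)` is `M(A ⊗̂ B)`. -/
abbrev CTensor (k A B : Type*) [NormedField k] [NormedCommRing A] [NormedAlgebra k A]
    [NormedCommRing B] [NormedAlgebra k B] : Type _ :=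
  UniformSpace.Completion (PreTensor k A B)

instance : IsUltrametricDist (CTensor k A B) :=
  IsUltrametricDist.isUltrametricDist_of_forall_norm_add_le_max_norm fun x y => by
    induction x, y using UniformSpace.Completion.induction_on₂ with
    | hp => exact isClosed_le (by fun_prop) (by fun_prop)
    | ih x y =>
      rw [← UniformSpace.Completion.coe_add]
      simp only [UniformSpace.Completion.norm_coe]
      exact PreTensor.seminorm_add_le_max x y

namespace CTensor

theorem coe_algebraMap (t : k) : ((algebraMap k (PreTensor k A B) t : PreTensor k A B) :
    CTensor k A B) = algebraMap k (CTensor k A B) t := rfl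

/-- `a ↦ a ⊗ 1`, the first projection `M(A) × M(B) → M(A)`. -/
def fst (k A B : Type*) [NormedField k] [NormedCommRing A] [NormedAlgebra k A]
    [NormedCommRing B] [NormedAlgebra k B] : BddHom k A (CTensor k A B) where
  toRingHom := (UniformSpace.Completion.coeRingHom (α := PreTensor k A B)).comp
    (Algebra.TensorProduct.includeLeft : A →ₐ[k] A ⊗[k] B).toRingHom
  commutes' := fun t => by
    rw [← coe_algebraMap]
    exact congrArg (UniformSpace.Completion.coeRingHom (α := PreTensor k A B))
      ((Algebra.TensorProduct.includeLeft : A →ₐ[k] A ⊗[k] B).commutes t)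
  bounded' := ⟨‖(1 : B)‖, fun a => by
    change ‖((PreTensor.tmul a 1 : PreTensor k A B) : CTensor k A B)‖ ≤ _
    rw [UniformSpace.Completion.norm_coe, mul_comm]
    exact PreTensor.norm_tmul_le a 1⟩

/-- `b ↦ 1 ⊗ b`, the second projection `M(A) × M(B) → M(B)`. -/
def snd (k A B : Type*) [NormedField k] [NormedCommRing A] [NormedAlgebra k A]
    [NormedCommRing B] [NormedAlgebra k B] : BddHom k B (CTensor k A B) where
  toRingHom := (UniformSpace.Completion.coeRingHom (α := PreTensor k A B)).comp
    (Algebra.TensorProduct.includeRight : B →ₐ[k] A ⊗[k] B).toRingHom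
  commutes' := fun t => by
    rw [← coe_algebraMap]
    exact congrArg (UniformSpace.Completion.coeRingHom (α := PreTensor k A B))
      ((Algebra.TensorProduct.includeRight : B →ₐ[k] A ⊗[k] B).commutes t)
  bounded' := ⟨‖(1 : A)‖, fun a => by
    change ‖((PreTensor.tmul 1 a : PreTensor k A B) : CTensor k A B)‖ ≤ _
    rw [UniformSpace.Completion.norm_coe]
    exact PreTensor.norm_tmul_le 1 a⟩

variable {C : Type*} [NormedCommRing C] [NormedAlgebra k C]

/-- `a ⊗ b ↦ u a * v b` on the algebraic tensor product. -/
def preLift (u : BddHom k A C) (v : BddHom k B C) : PreTensor k A B →ₐ[k] C :=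
  Algebra.TensorProduct.productMap u.toAlgHom v.toAlgHom

theorem preLift_tmul (u : BddHom k A C) (v : BddHom k B C) (a : A) (b : B) :
    preLift u v (PreTensor.tmul a b) = u a * v b :=
  Algebra.TensorProduct.productMap_apply_tmul u.toAlgHom v.toAlgHom a b

variable [IsUltrametricDist C]

theorem preLift_bounded (u : BddHom k A C) (v : BddHom k B C) :
    ∃ M : ℝ, 0 ≤ M ∧ ∀ x, ‖preLift u v x‖ ≤ M * ‖x‖ := by
  obtain ⟨c, hc, hu⟩ := u.bounded
  obtain ⟨d, hd, hv⟩ := v.bounded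
  have key : ∀ (e : ℝ), 0 ≤ e → ∀ x ∈ PreTensor.sums (k := k) (A := A) (B := B) e,
      ‖preLift u v x‖ ≤ c * d * e := by
    intro e he x hx
    induction hx using AddSubmonoid.closure_induction with
    | zero => rw [map_zero, norm_zero]; positivity
    | add x y _ _ hx hy =>
      rw [map_add]
      exact (IsUltrametricDist.norm_add_le_max _ _).trans (max_le hx hy)
    | mem x hx =>
      obtain ⟨a, b, hab, rfl⟩ := hx
      rw [preLift_tmul]
      calc ‖u a * v b‖ ≤ ‖u a‖ * ‖v b‖ := norm_mul_le _ _
        _ ≤ (c * ‖a‖) * (d * ‖b‖) := by gcongr <;> [exact hu a; exact hv b]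
        _ = c * d * (‖a‖ * ‖b‖) := by ring
        _ ≤ c * d * e := by gcongr
  refine ⟨c * d, by positivity, fun x => ?_⟩
  have hx := PreTensor.seminorm_nonneg x
  have ht : Tendsto (fun ε : ℝ => c * d * (PreTensor.seminorm x + ε)) (𝓝[>] 0)
      (𝓝 (c * d * (PreTensor.seminorm x + 0))) :=
    tendsto_nhdsWithin_of_tendsto_nhds (Continuous.tendsto (by fun_prop) 0)
  rw [add_zero] at ht
  refine ge_of_tendsto ht (eventually_mem_nhdsWithin.mono fun ε (hε : 0 < ε) => ?_)
  exact key _ (by positivity) x (PreTensor.mem_sums_of_lt (by linarith))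

theorem preLift_continuous (u : BddHom k A C) (v : BddHom k B C) :
    Continuous (preLift u v) := by
  obtain ⟨M, _, h⟩ := preLift_bounded u v
  exact AddMonoidHomClass.continuous_of_bound (preLift u v) M h

/-- The homomorphism `A ⊗̂ B → C`, `a ⊗ b ↦ u a * v b`. It corresponds to the morphism
`(u, v) : M(C) → M(A) × M(B)`. -/
def lift [CompleteSpace C] (u : BddHom k A C) (v : BddHom k B C) :
    BddHom k (CTensor k A B) C where
  toRingHom := UniformSpace.Completion.extensionHom (preLift u v).toRingHom
    (preLift_continuous u v)
  commutes' := fun t => by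
    rw [← coe_algebraMap]
    exact (UniformSpace.Completion.extensionHom_coe (preLift u v).toRingHom
      (preLift_continuous u v) _).trans ((preLift u v).commutes t)
  bounded' := by
    obtain ⟨M, hM, h⟩ := preLift_bounded u v
    refine ⟨M, fun x => ?_⟩
    change ‖UniformSpace.Completion.extensionHom (preLift u v).toRingHom
      (preLift_continuous u v) x‖ ≤ _
    induction x using UniformSpace.Completion.induction_on with
    | hp =>
      exact isClosed_le (UniformSpace.Completion.continuous_extension.norm) (by fun_prop)
    | ih x =>
      rw [UniformSpace.Completion.extensionHom_coe, UniformSpace.Completion.norm_coe]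
      exact h x

theorem lift_fst [CompleteSpace C] (u : BddHom k A C) (v : BddHom k B C) (a : A) :
    lift u v (fst k A B a) = u a := by
  refine (UniformSpace.Completion.extensionHom_coe (preLift u v).toRingHom
      (preLift_continuous u v) _).trans ((preLift_tmul u v a 1).trans ?_)
  have : v 1 = 1 := map_one v.toAlgHom
  rw [this, mul_one]

theorem lift_snd [CompleteSpace C] (u : BddHom k A C) (v : BddHom k B C) (b : B) :
    lift u v (snd k A B b) = v b := by
  refine (UniformSpace.Completion.extensionHom_coe (preLift u v).toRingHom
      (preLift_continuous u v) _).trans ((preLift_tmul u v 1 b).trans ?_)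
  have : u 1 = 1 := map_one u.toAlgHom
  rw [this, one_mul]

end CTensor

end PreTensor

/-! ### The unit disc and its additive group structure -/

/-- The algebra `k{T}` of the closed unit disc. -/
abbrev Disc (k : Type*) [NormedField k] [IsUltrametricDist k] : Type _ :=
  Tate k (fun _ : Unit => (⟨1, one_pos⟩ : {x : ℝ // 0 < x}))

namespace Disc

variable {k B : Type*} [NormedField k] [IsUltrametricDist k] [NormedCommRing B]
  [NormedAlgebra k B]

theorem norm_pow_le {b : B} (hb : ‖b‖ ≤ 1) (n : ℕ) : ‖b ^ n‖ ≤ max 1 ‖(1 : B)‖ := by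
  rcases Nat.eq_zero_or_pos n with rfl | hn
  · simp
  · exact (norm_pow_le' b hn).trans ((pow_le_one₀ (norm_nonneg _) hb).trans (le_max_left _ _))

theorem norm_term_le {b : B} (hb : ‖b‖ ≤ 1) (f : Disc k) (v : Unit →₀ ℕ) :
    ‖Tate.coeff v f • b ^ (v ())‖ ≤ max 1 ‖(1 : B)‖ * ‖Tate.coeff v f‖ := by
  rw [mul_comm]
  refine (norm_smul_le _ _).trans ?_
  gcongr
  exact norm_pow_le hb _

/-- The sum `∑ aₙ bⁿ`. -/
def evalFun (b : B) (f : Disc k) : B := ∑' v : Unit →₀ ℕ, Tate.coeff v f • b ^ (v ())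

theorem evalFun_C (b : B) (t : k) : evalFun b (algebraMap k (Disc k) t) = algebraMap k B t := by
  classical
  have hc : ∀ v : Unit →₀ ℕ, Tate.coeff v (algebraMap k (Disc k) t) = if v = 0 then t else 0 :=
    fun v => MvPowerSeries.coeff_C v t
  rw [evalFun, tsum_eq_single 0]
  · rw [hc, if_pos rfl, Finsupp.zero_apply, pow_zero, Algebra.algebraMap_eq_smul_one]
  · intro v hv
    rw [hc, if_neg hv, zero_smul]

variable [IsUltrametricDist B]

theorem norm_evalFun_le {b : B} (hb : ‖b‖ ≤ 1) (f : Disc k) :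
    ‖evalFun b f‖ ≤ max 1 ‖(1 : B)‖ * ‖f‖ := by
  refine IsUltrametricDist.norm_tsum_le_of_forall_le_of_nonneg (by positivity) fun v => ?_
  refine (norm_term_le hb f v).trans ?_
  gcongr
  simpa [Finsupp.prod] using Tate.le_norm f v

variable [CompleteSpace B]

theorem summable_term {b : B} (hb : ‖b‖ ≤ 1) (f : Disc k) :
    Summable fun v : Unit →₀ ℕ => Tate.coeff v f • b ^ (v ()) := by
  refine NonarchimedeanAddGroup.summable_of_tendsto_cofinite_zero ?_
  rw [tendsto_zero_iff_norm_tendsto_zero]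
  have h := (Tate.tendsto_coeff f).const_mul (max 1 ‖(1 : B)‖)
  simp only [one_pow, Finsupp.prod, Finset.prod_const_one, mul_one, mul_zero] at h
  exact squeeze_zero (fun _ => norm_nonneg _) (norm_term_le hb f) h

theorem evalFun_mul {b : B} (hb : ‖b‖ ≤ 1) (f g : Disc k) :
    evalFun b (f * g) = evalFun b f * evalFun b g := by
  classical
  have : NonarchimedeanRing B :=
    { is_nonarchimedean := NonarchimedeanAddGroup.is_nonarchimedean }
  have key : ∀ F G : (Unit →₀ ℕ) → B, Summable F → Summable G →
      (∑' v, F v) * ∑' v, G v =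
        ∑' v, ∑ p ∈ Finset.HasAntidiagonal.antidiagonal v, F p.1 * G p.2 :=
    fun F G hF hG =>
      hF.tsum_mul_tsum_eq_tsum_sum_antidiagonal hG (hF.mul_of_nonarchimedean hG)
  have h2 : ∀ v : Unit →₀ ℕ, Tate.coeff v (f * g) • b ^ (v ()) =
      ∑ p ∈ Finset.HasAntidiagonal.antidiagonal v,
        (Tate.coeff p.1 f • b ^ (p.1 ())) * (Tate.coeff p.2 g • b ^ (p.2 ())) := by
    intro v
    rw [Tate.coeff_mul, Finset.sum_smul]
    refine Finset.sum_congr rfl fun p hp => ?_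
    have h : p.1 () + p.2 () = v () := by
      rw [← Finset.HasAntidiagonal.mem_antidiagonal.mp hp, Finsupp.add_apply]
    rw [← h, pow_add, smul_mul_smul_comm]
  exact (tsum_congr h2).trans (key _ _ (summable_term hb f) (summable_term hb g)).symm

theorem evalFun_add {b : B} (hb : ‖b‖ ≤ 1) (f g : Disc k) :
    evalFun b (f + g) = evalFun b f + evalFun b g := by
  refine Eq.trans (tsum_congr fun v => ?_) ((summable_term hb f).tsum_add (summable_term hb g))
  rw [Tate.coeff_add, add_smul]

/-- For `b` in the unit ball of `B`, the homomorphism `k{T} → B`, `∑ aₙ Tⁿ ↦ ∑ aₙ bⁿ`. -/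
def eval (b : B) (hb : ‖b‖ ≤ 1) : BddHom k (Disc k) B where
  toFun := evalFun b
  map_one' := by
    rw [← map_one (algebraMap k (Disc k)), evalFun_C, map_one]
  map_mul' := evalFun_mul hb
  map_zero' := by
    rw [← map_zero (algebraMap k (Disc k)), evalFun_C, map_zero]
  map_add' := evalFun_add hb
  commutes' := evalFun_C b
  bounded' := ⟨_, norm_evalFun_le hb⟩

/-- The coordinate `T` of the disc. -/
def T (k : Type*) [NormedField k] [IsUltrametricDist k] : Disc k :=
  ⟨MvPowerSeries.X (), MvPowerSeries.isRestricted_monomial _ _ _⟩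

theorem norm_T_le : ‖T k‖ ≤ 1 := by
  classical
  rw [Tate.norm_eq]
  refine Real.iSup_le (fun v => ?_) zero_le_one
  change ‖MvPowerSeries.coeff v (MvPowerSeries.X () : MvPowerSeries Unit k)‖ * _ ≤ 1
  rw [MvPowerSeries.coeff_X]
  split_ifs <;> simp [Finsupp.prod]

theorem norm_one_le : ‖(1 : Disc k)‖ ≤ 1 := by
  classical
  rw [Tate.norm_eq]
  refine Real.iSup_le (fun v => ?_) zero_le_one
  change ‖MvPowerSeries.coeff v (1 : MvPowerSeries Unit k)‖ * _ ≤ 1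
  rw [MvPowerSeries.coeff_one]
  split_ifs <;> simp [Finsupp.prod]

theorem eval_T (b : B) (hb : ‖b‖ ≤ 1) : eval (k := k) b hb (T k) = b := by
  classical
  change ∑' v : Unit →₀ ℕ, MvPowerSeries.coeff v (MvPowerSeries.X () : MvPowerSeries Unit k) •
    b ^ (v ()) = b
  rw [tsum_eq_single (Finsupp.single () 1)]
  · simp
  · intro v hv
    rw [MvPowerSeries.coeff_X, if_neg hv, zero_smul]

theorem norm_fst_T_add_snd_T_le :
    ‖CTensor.fst k (Disc k) (Disc k) (T k) + CTensor.snd k (Disc k) (Disc k) (T k)‖ ≤ 1 := by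
  refine (IsUltrametricDist.norm_add_le_max _ _).trans (max_le ?_ ?_)
  · change ‖((PreTensor.tmul (T k) 1 : PreTensor k (Disc k) (Disc k)) :
      CTensor k (Disc k) (Disc k))‖ ≤ 1
    rw [UniformSpace.Completion.norm_coe]
    exact (PreTensor.norm_tmul_le _ _).trans
      (mul_le_one₀ norm_T_le (norm_nonneg _) norm_one_le)
  · change ‖((PreTensor.tmul 1 (T k) : PreTensor k (Disc k) (Disc k)) :
      CTensor k (Disc k) (Disc k))‖ ≤ 1
    rw [UniformSpace.Completion.norm_coe]
    exact (PreTensor.norm_tmul_le _ _).trans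
      (mul_le_one₀ norm_one_le (norm_nonneg _) norm_T_le)

/-- The addition `𝔻 × 𝔻 → 𝔻`, given by `T ↦ T ⊗ 1 + 1 ⊗ T`. -/
def add (k : Type*) [NormedField k] [IsUltrametricDist k] :
    BddHom k (Disc k) (CTensor k (Disc k) (Disc k)) :=
  eval (CTensor.fst k (Disc k) (Disc k) (T k) + CTensor.snd k (Disc k) (Disc k) (T k))
    norm_fst_T_add_snd_T_le

/-- The `k`-rational point of the disc defined by `c ∈ k` with `|c| ≤ 1`, given by `T ↦ c`. -/
def point [CompleteSpace k] (c : k) (hc : ‖c‖ ≤ 1) : BddHom k (Disc k) k := eval c hc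

end Disc

/-! ### Actions of the disc -/

section Action

variable {k A : Type*} [NormedField k] [IsUltrametricDist k] [CompleteSpace k]
  [NormedCommRing A] [NormedAlgebra k A] [IsUltrametricDist A] [CompleteSpace A]

/-- For a morphism `Φ : 𝔻 × M(A) → M(A)` and a point `c ∈ 𝔻(k)`, the endomorphism
`x ↦ Φ(c, x)` of `M(A)`. -/
def slice (Φ : BddHom k A (CTensor k (Disc k) A)) (c : k) (hc : ‖c‖ ≤ 1) : BddHom k A A :=
  (CTensor.lift ((BddHom.structureMap k A).comp (Disc.point c hc)) (BddHom.id k A)).comp Φ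

/-- A morphism `Φ : 𝔻 × M(A) → M(A)` is an action of the group `(𝔻, +)` if `Φ(0, x) = x` and
`Φ(s + t, x) = Φ(s, Φ(t, x))`; the second identity is one of morphisms `𝔻 × (𝔻 × M(A)) → M(A)`. -/
structure IsDiscAction (Φ : BddHom k A (CTensor k (Disc k) A)) : Prop where
  zero_act : slice Φ 0 (by simp) = BddHom.id k A
  add_act :
    let s : BddHom k (Disc k) (CTensor k (Disc k) (CTensor k (Disc k) A)) :=
      CTensor.fst k (Disc k) (CTensor k (Disc k) A)
    let t : BddHom k (Disc k) (CTensor k (Disc k) (CTensor k (Disc k) A)) :=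
      (CTensor.snd k (Disc k) (CTensor k (Disc k) A)).comp (CTensor.fst k (Disc k) A)
    let x : BddHom k A (CTensor k (Disc k) (CTensor k (Disc k) A)) :=
      (CTensor.snd k (Disc k) (CTensor k (Disc k) A)).comp (CTensor.snd k (Disc k) A)
    (CTensor.lift ((CTensor.lift s t).comp (Disc.add k)) x).comp Φ =
      (CTensor.lift s ((CTensor.lift t x).comp Φ)).comp Φ

end Action

/-! ### The spectral radius and the constant `R(k)` -/

/-- The operator norm of a bounded operator. -/
def opNorm {k A : Type*} [NormedField k] [NormedCommRing A] [NormedAlgebra k A]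
    (u : A →ₗ[k] A) : ℝ :=
  sInf {c : ℝ | 0 ≤ c ∧ ∀ x, ‖u x‖ ≤ c * ‖x‖}

/-- The spectral radius `inf ‖uⁿ‖^(1/n) = lim ‖uⁿ‖^(1/n)` of a bounded operator `u`. -/
def spectralRadius {k A : Type*} [NormedField k] [NormedCommRing A] [NormedAlgebra k A]
    (u : A →ₗ[k] A) : ℝ :=
  ⨅ n : ℕ+, opNorm (u ^ (n : ℕ)) ^ (1 / ((n : ℕ) : ℝ))

/-- The difference operator `Δ_f = f^* - id`. -/
def diffOp {k A : Type*} [NormedField k] [NormedCommRing A] [NormedAlgebra k A]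
    (f : BddHom k A A) : A →ₗ[k] A :=
  f.toAlgHom.toLinearMap - LinearMap.id

/-- The characteristic of the residue field of `k`. -/
def residueChar (k : Type*) [NormedField k] [IsUltrametricDist k] : ℕ :=
  ringChar (IsLocalRing.ResidueField (NormedField.valuation (K := k)).valuationSubring)

open Classical in
/-- `R(k) = 1` if the residue field has characteristic `0`, and `R(k) = |p|^(1/(p-1))` if it has
characteristic `p > 0`. If the absolute value is normalized by `|p| = p⁻¹`, the latter is
`p^(-1/(p-1))`. -/
def R (k : Type*) [NormedField k] [IsUltrametricDist k] : ℝ :=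
  if residueChar k = 0 then 1
  else ‖(residueChar k : k)‖ ^ (1 / ((residueChar k : ℝ) - 1))

theorem norm_natCast_le_one (k : Type*) [NormedField k] [IsUltrametricDist k] (n : ℕ) :
    ‖(n : k)‖ ≤ 1 :=
  IsUltrametricDist.norm_natCast_le_one k n

end Berk

end

/-!
The algebra `k{T} ⊗̂ A` of the product `𝔻 × M(A)` consists of the power series in `T` whose
coefficients lie in `A` and tend to `0` (`CTensor.tendsto_trunc`). The proof rests on the identity
principle `eq_of_evalAt`: such a series is determined by its values at the natural numbers. If
some positive integer `p` has absolute value `< 1`, the zeros `pʲ` accumulate at `0`; otherwise all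
positive integers have absolute value `1`, and the `N`-th finite difference at `0` recovers the
`N`-th coefficient up to a unit and the later coefficients.

This gives uniqueness at once: a morphism `Φ` is determined by its restrictions to the fibres over
the natural numbers, which are prescribed to be the iterates of `f`.

For existence, put `Δ = f^* - id` and let `Φ` be given by `(1 + Δ)ᵀ`, that is, by the binomial
series `a ↦ ∑ binom(T, n) ⊗ Δⁿ a` (`flow`). The Gauss norm of `binom(T, n)` is at most `1 / |n!|`,
and Legendre's formula yields `|n!| ≥ R(k)ⁿ` (`R_pow_le_norm_factorial`). As the spectral radius of
`Δ` is smaller than `R(k)`, the series is dominated by a geometric one. By Newton's formula its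
value at a natural number `m` is `(1 + Δ)ᵐ a = (f^*)ᵐ a`. The identity principle then transfers
identities from the iterates to `Φ`: it is a homomorphism of algebras because all the iterates
are, and it satisfies the law of an action because `fᵐ⁺ⁿ = fᵐ ∘ fⁿ`
(`isDiscAction_of_slice_eq_iterate`).
-/

noncomputable section

namespace Berk

/-! ### Homomorphisms out of completed tensor products -/

section General

variable {k A B C : Type*} [NormedField k] [NormedCommRing A] [NormedAlgebra k A]
  [NormedCommRing B] [NormedAlgebra k B] [NormedCommRing C] [NormedAlgebra k C]

theorem BddHom.ext {f g : BddHom k A B} (h : ∀ x, f x = g x) : f = g := DFunLike.ext f g h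

theorem BddHom.comp_apply (g : BddHom k B C) (f : BddHom k A B) (x : A) :
    g.comp f x = g (f x) := rfl

instance : AlgHomClass (BddHom k A B) k A B where
  map_add f := map_add f.toAlgHom
  map_zero f := map_zero f.toAlgHom
  map_mul f := map_mul f.toAlgHom
  map_one f := map_one f.toAlgHom
  commutes f := f.toAlgHom.commutes

theorem BddHom.continuous (f : BddHom k A B) : Continuous f := by
  obtain ⟨M, _, h⟩ := f.bounded
  exact AddMonoidHomClass.continuous_of_bound f M h

theorem CTensor.fst_mul_snd (a : A) (b : B) :
    CTensor.fst k A B a * CTensor.snd k A B b =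
      ((PreTensor.tmul a b : PreTensor k A B) : CTensor k A B) := by
  refine (UniformSpace.Completion.coe_mul _ _).symm.trans (congrArg _ ?_)
  exact (Algebra.TensorProduct.tmul_mul_tmul a 1 1 b).trans (by rw [mul_one, one_mul]; rfl)

theorem CTensor.norm_fst_mul_snd_le (a : A) (b : B) :
    ‖CTensor.fst k A B a * CTensor.snd k A B b‖ ≤ ‖a‖ * ‖b‖ := by
  rw [CTensor.fst_mul_snd, UniformSpace.Completion.norm_coe]
  exact PreTensor.norm_tmul_le a b

/-- To check a closed condition on `A ⊗̂ B` it suffices to check it on the algebraic tensor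
product. -/
theorem CTensor.induction {p : CTensor k A B → Prop} (hp : IsClosed {x | p x})
    (h0 : p 0) (htmul : ∀ a b, p (CTensor.fst k A B a * CTensor.snd k A B b))
    (hadd : ∀ x y, p x → p y → p (x + y)) (x : CTensor k A B) : p x := by
  induction x using UniformSpace.Completion.induction_on with
  | hp => exact hp
  | ih x =>
    induction x using TensorProduct.induction_on with
    | zero => exact h0
    | tmul a b => have h := htmul a b; rwa [CTensor.fst_mul_snd] at h
    | add x y hx hy =>
      exact Eq.mp (congrArg p (UniformSpace.Completion.coe_add (α := PreTensor k A B) x y).symm)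
        (hadd _ _ hx hy)

theorem CTensor.hom_ext {f g : BddHom k (CTensor k A B) C}
    (h₁ : ∀ a, f (CTensor.fst k A B a) = g (CTensor.fst k A B a))
    (h₂ : ∀ b, f (CTensor.snd k A B b) = g (CTensor.snd k A B b)) : f = g := by
  refine BddHom.ext fun x => ?_
  induction x using CTensor.induction with
  | hp => exact isClosed_eq f.continuous g.continuous
  | h0 => rw [map_zero, map_zero]
  | htmul a b => rw [map_mul, map_mul, h₁, h₂]
  | hadd x y hx hy => rw [map_add, map_add, hx, hy]

end General

/-! ### The coefficients of an element of `k{T} ⊗̂ A` -/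

section Coefficients

variable {k A : Type*} [NormedField k] [IsUltrametricDist k] [NormedCommRing A]
  [NormedAlgebra k A]

namespace Disc

theorem norm_coeff_le (v : Unit →₀ ℕ) (f : Disc k) : ‖Tate.coeff v f‖ ≤ ‖f‖ := by
  simpa [Finsupp.prod] using Tate.le_norm f v

theorem norm_le_iff {f : Disc k} {c : ℝ} (hc : 0 ≤ c) :
    ‖f‖ ≤ c ↔ ∀ v, ‖Tate.coeff v f‖ ≤ c := by
  refine ⟨fun h v => (norm_coeff_le v f).trans h, fun h => ?_⟩
  rw [Tate.norm_eq]
  refine Real.iSup_le (fun v => ?_) hc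
  simpa [Finsupp.prod] using h v

theorem norm_T_pow_le (n : ℕ) : ‖(T k) ^ n‖ ≤ 1 := by
  induction n with
  | zero => rw [pow_zero]; exact norm_one_le
  | succ n ih =>
    rw [pow_succ]
    exact (norm_mul_le _ _).trans (mul_le_one₀ ih (norm_nonneg _) norm_T_le)

theorem coeff_T_pow (v : Unit →₀ ℕ) (n : ℕ) :
    Tate.coeff v ((T k) ^ n) = if v () = n then 1 else 0 := by
  classical
  change MvPowerSeries.coeff v ((MvPowerSeries.X () : MvPowerSeries Unit k) ^ n) = _
  rw [MvPowerSeries.coeff_X_pow]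
  congr 1
  rw [eq_iff_iff]
  constructor
  · rintro rfl; simp
  · intro h; ext; simpa using h

/-- The coefficient of `Tⁿ` in `∑ aₙ Tⁿ`, as a linear form. -/
def coeffₗ (n : ℕ) : Disc k →ₗ[k] k where
  toFun := Tate.coeff (Finsupp.single () n)
  map_add' := Tate.coeff_add _
  map_smul' a f := Tate.coeff_smul _ a f

theorem coeffₗ_T_pow (m n : ℕ) : coeffₗ m ((T k) ^ n) = if m = n then 1 else 0 := by
  change Tate.coeff (Finsupp.single () m) (T k ^ n) = _
  rw [coeff_T_pow, Finsupp.single_eq_same]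

theorem norm_coeffₗ_le (n : ℕ) (f : Disc k) : ‖coeffₗ n f‖ ≤ ‖f‖ := norm_coeff_le _ _

theorem coeff_eq_coeffₗ (v : Unit →₀ ℕ) (f : Disc k) : Tate.coeff v f = coeffₗ (v ()) f :=
  congrArg (fun w => Tate.coeff w f) (by ext; simp)

theorem tendsto_coeffₗ (f : Disc k) : Tendsto (fun n => ‖coeffₗ n f‖) atTop (𝓝 0) := by
  have h := Tate.tendsto_coeff f
  simp only [one_pow, Finsupp.prod, Finset.prod_const_one, mul_one] at h
  rw [← Nat.cofinite_eq_atTop]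
  exact h.comp (Finsupp.single_injective ()).tendsto_cofinite

/-- Every element of `k{T}` is the limit of its truncations. -/
theorem tendsto_trunc (f : Disc k) :
    Tendsto (fun N => ∑ i ∈ Finset.range N, coeffₗ i f • (T k) ^ i) atTop (𝓝 f) := by
  rw [tendsto_iff_norm_sub_tendsto_zero, Metric.tendsto_atTop]
  intro ε hε
  obtain ⟨N, hN⟩ := (Metric.tendsto_atTop.mp (tendsto_coeffₗ f)) (ε / 2) (half_pos hε)
  refine ⟨N, fun n hn => ?_⟩
  rw [dist_zero_right, norm_norm]
  refine lt_of_le_of_lt ((norm_le_iff (half_pos hε).le).mpr fun v => ?_) (half_lt_self hε)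
  rw [coeff_eq_coeffₗ, map_sub, map_sum]
  simp only [map_smul, coeffₗ_T_pow, smul_eq_mul, mul_ite, mul_one, mul_zero,
    Finset.sum_ite_eq, Finset.mem_range]
  split_ifs with h
  · simpa using (half_pos hε).le
  · have := hN (v ()) (by omega)
    rw [dist_zero_right, norm_norm] at this
    simpa using this.le

theorem hom_ext {B : Type*} [NormedCommRing B] [NormedAlgebra k B] {f g : BddHom k (Disc k) B}
    (h : f (T k) = g (T k)) : f = g := by
  refine BddHom.ext fun x => ?_
  refine tendsto_nhds_unique ((f.continuous.tendsto x).comp (tendsto_trunc x)) ?_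
  refine ((g.continuous.tendsto x).comp (tendsto_trunc x)).congr fun N => ?_
  simp only [Function.comp_apply, map_sum, map_smul, map_pow, h]

end Disc

namespace CTensor

/-- The map `g ⊗ a ↦ gₙ a` on the algebraic tensor product `k{T} ⊗ A`. -/
def preCoeff (n : ℕ) : PreTensor k (Disc k) A →ₗ[k] A :=
  TensorProduct.lift ((LinearMap.lsmul k A).comp (Disc.coeffₗ n))

theorem preCoeff_tmul (n : ℕ) (g : Disc k) (a : A) :
    preCoeff n (PreTensor.tmul g a) = Disc.coeffₗ n g • a := rfl

variable [IsUltrametricDist A]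

theorem norm_preCoeff_le (n : ℕ) (x : PreTensor k (Disc k) A) : ‖preCoeff n x‖ ≤ 1 * ‖x‖ := by
  rw [one_mul]
  refine le_of_forall_gt_imp_ge_of_dense fun c hc => ?_
  have hc0 : 0 ≤ c := (norm_nonneg x).trans hc.le
  have hx := PreTensor.mem_sums_of_lt hc
  clear hc
  induction hx using AddSubmonoid.closure_induction with
  | zero => rwa [map_zero, norm_zero]
  | add x y _ _ hx hy =>
    rw [map_add]
    exact (IsUltrametricDist.norm_add_le_max _ _).trans (max_le hx hy)
  | mem x hx =>
    obtain ⟨g, a, hga, rfl⟩ := hx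
    rw [preCoeff_tmul]
    refine (norm_smul_le _ _).trans (le_trans ?_ hga)
    gcongr
    exact Disc.norm_coeffₗ_le n g

variable [CompleteSpace A]

/-- The coefficient `aₙ ∈ A` of an element `∑ Tⁿ ⊗ aₙ` of `k{T} ⊗̂ A`. -/
def coeff (n : ℕ) : NormedAddGroupHom (CTensor k (Disc k) A) A :=
  NormedAddGroupHom.extension
    ((preCoeff n).toAddMonoidHom.mkNormedAddGroupHom 1 (norm_preCoeff_le n))

theorem coeff_fst_mul_snd (n : ℕ) (g : Disc k) (a : A) :
    coeff n (CTensor.fst k (Disc k) A g * CTensor.snd k (Disc k) A a) = Disc.coeffₗ n g • a := by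
  rw [CTensor.fst_mul_snd]
  exact NormedAddGroupHom.extension_coe _ _

theorem norm_coeff_le (n : ℕ) (x : CTensor k (Disc k) A) : ‖coeff n x‖ ≤ ‖x‖ := by
  induction x using UniformSpace.Completion.induction_on with
  | hp => exact isClosed_le (coeff n).continuous.norm continuous_norm
  | ih x =>
    rw [UniformSpace.Completion.norm_coe, coeff, NormedAddGroupHom.extension_coe]
    exact (norm_preCoeff_le n x).trans_eq (one_mul _)

/-- The truncation `∑_{i < N} Tⁱ ⊗ aᵢ` of `∑ Tⁱ ⊗ aᵢ`. -/
def trunc (N : ℕ) (x : CTensor k (Disc k) A) : CTensor k (Disc k) A :=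
  ∑ i ∈ Finset.range N,
    CTensor.fst k (Disc k) A (Disc.T k ^ i) * CTensor.snd k (Disc k) A (coeff i x)

theorem trunc_add (N : ℕ) (x y : CTensor k (Disc k) A) :
    trunc N (x + y) = trunc N x + trunc N y := by
  simp only [trunc, map_add, mul_add, Finset.sum_add_distrib]

theorem norm_trunc_le (N : ℕ) (x : CTensor k (Disc k) A) : ‖trunc N x‖ ≤ ‖x‖ := by
  refine IsUltrametricDist.norm_sum_le_of_forall_le_of_nonneg (norm_nonneg _) fun i _ => ?_
  refine (norm_fst_mul_snd_le _ _).trans ?_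
  calc _ ≤ 1 * ‖x‖ := by gcongr <;> [exact Disc.norm_T_pow_le i; exact norm_coeff_le i x]
    _ = ‖x‖ := one_mul _

/-- Every element of `k{T} ⊗̂ A` is a power series in `T` with coefficients in `A`. The truncations
are linear of norm at most `1`, so that it is enough to look at elementary tensors. -/
theorem tendsto_trunc (x : CTensor k (Disc k) A) :
    Tendsto (fun N => trunc N x) atTop (𝓝 x) := by
  induction x using CTensor.induction with
  | hp =>
    refine isClosed_of_closure_subset fun x hx => ?_
    rw [Set.mem_ofPred_eq, Metric.tendsto_atTop]
    intro ε hε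
    obtain ⟨y, hy, hxy⟩ := Metric.mem_closure_iff.mp hx ε hε
    obtain ⟨N, hN⟩ := Metric.tendsto_atTop.mp hy ε hε
    refine ⟨N, fun n hn => ?_⟩
    have h1 : dist (trunc n x) (trunc n y) < ε := by
      have h : trunc n x = trunc n (x - y) + trunc n y := by rw [← trunc_add, sub_add_cancel]
      rw [dist_eq_norm, h, add_sub_cancel_right]
      exact (norm_trunc_le n _).trans_lt (by rwa [← dist_eq_norm])
    have h2 : dist (trunc n x) y < ε :=
      (dist_triangle_max _ (trunc n y) _).trans_lt (max_lt h1 (hN n hn))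
    exact (dist_triangle_max _ y _).trans_lt (max_lt h2 (by rwa [dist_comm]))
  | h0 => simp [trunc]
  | htmul g a =>
    have h := ((CTensor.fst k (Disc k) A).continuous.tendsto g).comp (Disc.tendsto_trunc g)
    refine (h.mul_const (CTensor.snd k (Disc k) A a)).congr fun N => ?_
    simp only [Function.comp_apply, trunc, map_sum, map_smul, coeff_fst_mul_snd, Finset.sum_mul,
      smul_mul_assoc, mul_smul_comm]
  | hadd x y hx hy => simpa only [trunc_add] using hx.add hy

end CTensor

/-! ### Restriction to the rational points of the disc -/

variable [CompleteSpace k] [IsUltrametricDist A] [CompleteSpace A]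

/-- The restriction `k{T} ⊗̂ A → A` of functions on `𝔻 × M(A)` to the fibre over `c ∈ 𝔻(k)`. -/
def evalAt (A : Type*) [NormedCommRing A] [NormedAlgebra k A] [IsUltrametricDist A]
    [CompleteSpace A] (c : k) (hc : ‖c‖ ≤ 1) : BddHom k (CTensor k (Disc k) A) A :=
  CTensor.lift ((BddHom.structureMap k A).comp (Disc.point c hc)) (BddHom.id k A)

theorem evalAt_fst (c : k) (hc : ‖c‖ ≤ 1) (g : Disc k) :
    evalAt A c hc (CTensor.fst k (Disc k) A g) = algebraMap k A (Disc.point c hc g) :=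
  CTensor.lift_fst _ _ _

theorem evalAt_snd (c : k) (hc : ‖c‖ ≤ 1) (a : A) :
    evalAt A c hc (CTensor.snd k (Disc k) A a) = a :=
  CTensor.lift_snd _ _ _

theorem tendsto_evalAt (c : k) (hc : ‖c‖ ≤ 1) (x : CTensor k (Disc k) A) :
    Tendsto (fun N => ∑ i ∈ Finset.range N, c ^ i • CTensor.coeff i x) atTop
      (𝓝 (evalAt A c hc x)) := by
  refine (((evalAt A c hc).continuous.tendsto x).comp (CTensor.tendsto_trunc x)).congr fun N => ?_
  simp only [Function.comp_apply, CTensor.trunc, map_sum, map_mul, evalAt_fst, evalAt_snd, map_pow,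
    Disc.point, Disc.eval_T, Algebra.smul_def]

end Coefficients

/-! ### The identity principle -/

section IdentityPrinciple

variable {k A : Type*} [NormedField k] [NormedCommRing A] [NormedAlgebra k A]

/-- In a sum `∑ eᵢ aᵢ` with value `0`, no term is larger than all the others. -/
theorem norm_smul_le_of_tendsto_zero [IsUltrametricDist A] {e : ℕ → k} {a : ℕ → A} {m : ℕ} {δ : ℝ}
    (h : Tendsto (fun N => ∑ i ∈ Finset.range N, e i • a i) atTop (𝓝 0))
    (hδ : ∀ i ≠ m, ‖e i • a i‖ ≤ δ) : ‖e m • a m‖ ≤ δ := by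
  have hδ0 : 0 ≤ δ := (norm_nonneg _).trans (hδ (m + 1) (by omega))
  have hlim := (h.sub_const (e m • a m)).norm
  rw [zero_sub, norm_neg] at hlim
  refine le_of_tendsto hlim ((eventually_gt_atTop m).mono fun N hN => ?_)
  rw [← Finset.add_sum_erase _ _ (Finset.mem_range.mpr hN), add_sub_cancel_left]
  exact IsUltrametricDist.norm_sum_le_of_forall_le_of_nonneg hδ0
    fun i hi => hδ i (Finset.ne_of_mem_erase hi)

theorem tendsto_zero_of_tendsto_sum {a : ℕ → A} {x : A}
    (h : Tendsto (fun N => ∑ i ∈ Finset.range N, a i) atTop (𝓝 x)) : Tendsto a atTop (𝓝 0) := by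
  have := (h.comp (tendsto_add_atTop_nat 1)).sub h
  rw [sub_self] at this
  refine this.congr fun N => ?_
  simp only [Function.comp_apply, Finset.sum_range_succ, add_sub_cancel_left]

/-- The coefficient `Δᴺ(xⁱ)(0)` with which `aᵢ` contributes to the `N`-th difference at `0` of
`∑ aᵢ xⁱ`. -/
def diffCoeff (k : Type*) [NormedField k] (N i : ℕ) : k :=
  ∑ j ∈ Finset.range (N + 1), (((-1) ^ (N - j) * (N.choose j : ℤ) : ℤ) : k) * (j : k) ^ i

theorem diffCoeff_eq (N i : ℕ) : diffCoeff k N i = (fwdDiff 1)^[N] (fun r : k => r ^ i) 0 := by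
  rw [fwdDiff_iter_eq_sum_shift, diffCoeff]
  refine Finset.sum_congr rfl fun j _ => ?_
  rw [zsmul_eq_mul, zero_add, nsmul_one]

variable [IsUltrametricDist A]

/-- If `|p| < 1` for a positive integer `p`, a power series vanishing at all the integers `pʲ` is
zero: these accumulate at `0`. -/
theorem eq_zero_of_eval_pow_eq_zero {a : ℕ → A} {p : ℕ} (hp0 : (p : k) ≠ 0) (hp1 : ‖(p : k)‖ < 1)
    (ha : Tendsto a atTop (𝓝 0))
    (h : ∀ j : ℕ, Tendsto (fun N => ∑ i ∈ Finset.range N, ((p : k) ^ j) ^ i • a i) atTop (𝓝 0))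
    (m : ℕ) : a m = 0 := by
  induction m using Nat.strong_induction_on with
  | _ m ih =>
    obtain ⟨M, hM⟩ := ha.norm.bddAbove_range
    have hM' : ∀ i, ‖a i‖ ≤ M := fun i => hM ⟨i, rfl⟩
    have key : ∀ j : ℕ, ‖a m‖ ≤ ‖(p : k)‖ ^ j * M := fun j => by
      have hc0 : 0 < ‖(p : k) ^ j‖ := norm_pos_iff.mpr (pow_ne_zero _ hp0)
      have hc1 : ‖(p : k) ^ j‖ ≤ 1 := by
        rw [norm_pow]; exact pow_le_one₀ (norm_nonneg _) hp1.le
      have hM0 : 0 ≤ M := (norm_nonneg _).trans (hM' 0)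
      have hle := norm_smul_le_of_tendsto_zero (m := m)
        (δ := ‖(p : k) ^ j‖ ^ (m + 1) * M) (h j) fun i hi => by
          rcases lt_or_gt_of_ne hi with hi | hi
          · rw [ih i hi, smul_zero, norm_zero]; positivity
          · rw [norm_smul, norm_pow _ i]
            exact mul_le_mul (pow_le_pow_of_le_one hc0.le hc1 hi) (hM' i) (norm_nonneg _)
              (by positivity)
      rw [norm_smul, norm_pow _ m, pow_succ, mul_assoc] at hle
      have := le_of_mul_le_mul_left hle (by positivity)
      rwa [norm_pow] at this
    have hlim := (tendsto_pow_atTop_nhds_zero_of_lt_one (norm_nonneg _) hp1).mul_const M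
    rw [zero_mul] at hlim
    exact norm_le_zero_iff.mp (ge_of_tendsto' hlim key)

variable [IsUltrametricDist k]

theorem norm_diffCoeff_le (N i : ℕ) : ‖diffCoeff k N i‖ ≤ 1 := by
  refine IsUltrametricDist.norm_sum_le_of_forall_le_of_nonneg zero_le_one fun j _ => ?_
  rw [norm_mul, norm_pow]
  exact mul_le_one₀ (IsUltrametricDist.norm_intCast_le_one k _) (by positivity)
    (pow_le_one₀ (norm_nonneg _) (norm_natCast_le_one k j))

/-- If all the positive integers are units of the valuation ring, a power series vanishing at all
the natural numbers is zero: its `N`-th difference at `0` is `N! a_N` up to the higher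
coefficients, so that no coefficient is larger than all the later ones. -/
theorem eq_zero_of_eval_natCast_eq_zero {a : ℕ → A} (hk : ∀ n : ℕ, n ≠ 0 → ‖(n : k)‖ = 1)
    (ha : Tendsto a atTop (𝓝 0))
    (h : ∀ j : ℕ, Tendsto (fun N => ∑ i ∈ Finset.range N, (j : k) ^ i • a i) atTop (𝓝 0))
    (m : ℕ) : a m = 0 := by
  have step : ∀ (N : ℕ) (δ : ℝ), 0 ≤ δ → (∀ i > N, ‖a i‖ ≤ δ) → ‖a N‖ ≤ δ := by
    intro N δ hδ hi
    have hlim : Tendsto (fun L => ∑ i ∈ Finset.range L, diffCoeff k N i • a i) atTop (𝓝 0) := by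
      have := tendsto_finsetSum (Finset.range (N + 1)) fun j _ =>
        (h j).const_smul (((-1) ^ (N - j) * (N.choose j : ℤ) : ℤ) : k)
      simp only [smul_zero, Finset.sum_const_zero] at this
      refine this.congr fun L => ?_
      simp only [diffCoeff, Finset.sum_smul, Finset.smul_sum, smul_smul]
      exact Finset.sum_comm
    have hle := norm_smul_le_of_tendsto_zero (m := N) hlim (δ := δ) fun i hne => by
      rcases lt_or_gt_of_ne hne with hlt | hgt
      · rw [diffCoeff_eq, fwdDiff_iter_pow_eq_zero_of_lt hlt]
        simpa using hδ
      · rw [norm_smul]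
        exact (mul_le_mul (norm_diffCoeff_le N i) (hi i hgt) (norm_nonneg _) zero_le_one).trans_eq
          (one_mul δ)
    rw [diffCoeff_eq, fwdDiff_iter_eq_factorial, norm_smul, Pi.natCast_apply,
      hk _ (Nat.factorial_ne_zero N), one_mul] at hle
    exact hle
  refine norm_le_zero_iff.mp (le_of_forall_pos_le_add fun ε hε => ?_)
  rw [zero_add]
  obtain ⟨N, hN⟩ := Metric.tendsto_atTop.mp ha ε hε
  have key : ∀ d i : ℕ, N ≤ i + d → ‖a i‖ ≤ ε := by
    intro d
    induction d with
    | zero => intro i hi; simpa using (hN i hi).le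
    | succ d ih => exact fun i hi => step i ε hε.le fun i' hi' => ih i' (by omega)
  exact key N m (by omega)

variable [CompleteSpace k] [CompleteSpace A]

/-- The identity principle: a function on `𝔻 × M(A)` which vanishes on the fibres over the natural
numbers is zero. -/
theorem eq_zero_of_evalAt [CharZero k] {x : CTensor k (Disc k) A}
    (h : ∀ n : ℕ, evalAt A (n : k) (norm_natCast_le_one k n) x = 0) : x = 0 := by
  have hlim : ∀ n : ℕ, Tendsto (fun N => ∑ i ∈ Finset.range N, (n : k) ^ i • CTensor.coeff i x)
      atTop (𝓝 0) := fun n => by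
    have := tendsto_evalAt (n : k) (norm_natCast_le_one k n) x
    rwa [h n] at this
  -- the coefficients tend to zero because the series converges at `1`
  have ha : Tendsto (fun i => CTensor.coeff i x) atTop (𝓝 0) :=
    tendsto_zero_of_tendsto_sum (by simpa using hlim 1)
  have hcoeff : ∀ i, CTensor.coeff i x = 0 := by
    by_cases hk : ∃ p : ℕ, p ≠ 0 ∧ ‖(p : k)‖ < 1
    · obtain ⟨p, hp0, hp1⟩ := hk
      exact eq_zero_of_eval_pow_eq_zero (Nat.cast_ne_zero.mpr hp0) hp1 ha
        fun j => by simpa using hlim (p ^ j)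
    · push Not at hk
      exact eq_zero_of_eval_natCast_eq_zero
        (fun n hn => (norm_natCast_le_one k n).antisymm (hk n hn)) ha hlim
  refine tendsto_nhds_unique (CTensor.tendsto_trunc x) ?_
  simp [CTensor.trunc, hcoeff]

theorem eq_of_evalAt [CharZero k] {x y : CTensor k (Disc k) A}
    (h : ∀ n : ℕ, evalAt A (n : k) (norm_natCast_le_one k n) x =
      evalAt A (n : k) (norm_natCast_le_one k n) y) : x = y :=
  sub_eq_zero.mp (eq_zero_of_evalAt fun n => by rw [map_sub, h, sub_self])

end IdentityPrinciple

/-! ### The constant `R(k)` and the spectral radius -/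

section Radius

variable (k : Type*) [NormedField k] [IsUltrametricDist k]

theorem residueChar_dvd_iff (n : ℕ) : residueChar k ∣ n ↔ ‖(n : k)‖ < 1 := by
  rw [residueChar, ← ringChar.spec,
    ← map_natCast (IsLocalRing.residue (NormedField.valuation (K := k)).valuationSubring),
    IsLocalRing.residue_eq_zero_iff, Valuation.mem_maximalIdeal_iff]
  rfl

theorem norm_eq_one_of_not_residueChar_dvd {n : ℕ} (h : ¬ residueChar k ∣ n) : ‖(n : k)‖ = 1 :=
  (norm_natCast_le_one k n).antisymm (not_lt.mp fun hn => h ((residueChar_dvd_iff k n).mpr hn))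

theorem residueChar_prime (h : residueChar k ≠ 0) : (residueChar k).Prime :=
  (CharP.char_is_prime_or_zero
    (IsLocalRing.ResidueField (NormedField.valuation (K := k)).valuationSubring)
    (residueChar k)).resolve_right h

theorem norm_natCast_eq_norm_residueChar_pow (h : residueChar k ≠ 0) {n : ℕ} (hn : n ≠ 0) :
    ‖(n : k)‖ = ‖(residueChar k : k)‖ ^ padicValNat (residueChar k) n := by
  have hp := residueChar_prime k h
  obtain ⟨e, m, hm, rfl⟩ := Nat.exists_eq_pow_mul_and_not_dvd hn (residueChar k) hp.ne_one
  have : Fact (residueChar k).Prime := ⟨hp⟩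
  rw [padicValNat.mul (pow_ne_zero _ hp.ne_zero) (by rintro rfl; simp at hm),
    padicValNat.prime_pow, padicValNat.eq_zero_of_not_dvd hm, add_zero, Nat.cast_mul, norm_mul,
    norm_eq_one_of_not_residueChar_dvd k hm, mul_one, Nat.cast_pow, norm_pow]

variable [CharZero k]

theorem R_pos : 0 < R k := by
  rw [R]
  split_ifs with h
  · exact one_pos
  · exact Real.rpow_pos_of_pos (norm_pos_iff.mpr (Nat.cast_ne_zero.mpr h)) _

/-- The bound `R(k)ⁿ ≤ |n!|`, by Legendre's formula `(p - 1) vₚ(n!) ≤ n`. -/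
theorem R_pow_le_norm_factorial (n : ℕ) : R k ^ n ≤ ‖(n.factorial : k)‖ := by
  rw [R]
  split_ifs with h
  · rw [one_pow, norm_eq_one_of_not_residueChar_dvd]
    rw [h, zero_dvd_iff]
    exact Nat.factorial_ne_zero n
  · have hp := residueChar_prime k h
    have : Fact (residueChar k).Prime := ⟨hp⟩
    rw [norm_natCast_eq_norm_residueChar_pow k h (Nat.factorial_ne_zero n), ← Real.rpow_natCast,
      ← Real.rpow_mul (norm_nonneg _), ← Real.rpow_natCast]
    refine Real.rpow_le_rpow_of_exponent_ge (norm_pos_iff.mpr (Nat.cast_ne_zero.mpr h))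
      (norm_natCast_le_one k _) ?_
    have hp1 : (0 : ℝ) < (residueChar k : ℝ) - 1 := sub_pos.mpr (by exact_mod_cast hp.one_lt)
    rw [one_div_mul_eq_div, le_div_iff₀ hp1, mul_comm]
    have hL : (residueChar k - 1) * padicValNat (residueChar k) n.factorial ≤ n :=
      (sub_one_mul_padicValNat_factorial n).trans_le (Nat.sub_le _ _)
    rw [← Nat.cast_one, ← Nat.cast_sub hp.one_le]
    exact_mod_cast hL

end Radius

section Spectral

variable {k A : Type*} [NormedField k] [NormedCommRing A] [NormedAlgebra k A]

theorem norm_pow_apply_le {u : A →ₗ[k] A} {B : ℝ} (hB : 0 ≤ B) (hu : ∀ x, ‖u x‖ ≤ B * ‖x‖)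
    (n : ℕ) (x : A) : ‖(u ^ n) x‖ ≤ B ^ n * ‖x‖ := by
  induction n with
  | zero => simp
  | succ n ih =>
    rw [pow_succ', Module.End.mul_apply, pow_succ', mul_assoc]
    exact (hu _).trans (by gcongr)

/-- A bounded operator of spectral radius `< ρ` satisfies `‖uⁿ‖ ≤ C rⁿ` for some `r < ρ`. -/
theorem exists_norm_pow_le_of_spectralRadius_lt {u : A →ₗ[k] A} {B ρ : ℝ}
    (hB : 0 ≤ B) (hu : ∀ x, ‖u x‖ ≤ B * ‖x‖) (h : spectralRadius u < ρ) :
    ∃ r C : ℝ, 0 < r ∧ r < ρ ∧ 0 ≤ C ∧ ∀ (n : ℕ) (x : A), ‖(u ^ n) x‖ ≤ C * r ^ n * ‖x‖ := by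
  have hop : ∀ m : ℕ, 0 ≤ opNorm (u ^ m) := fun m => Real.sInf_nonneg fun _ h => h.1
  obtain ⟨m, hm⟩ := exists_lt_of_ciInf_lt h
  obtain ⟨r, hr, hrρ⟩ := exists_between hm
  have hr0 : 0 < r := (Real.rpow_nonneg (hop _) _).trans_lt hr
  have hmr : opNorm (u ^ (m : ℕ)) < r ^ (m : ℕ) := by
    have := pow_lt_pow_left₀ hr (Real.rpow_nonneg (hop _) _) m.pos.ne'
    rwa [one_div, Real.rpow_inv_natCast_pow (hop _) m.pos.ne'] at this
  have hne : {c : ℝ | 0 ≤ c ∧ ∀ x, ‖(u ^ (m : ℕ)) x‖ ≤ c * ‖x‖}.Nonempty :=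
    ⟨B ^ (m : ℕ), by positivity, norm_pow_apply_le hB hu _⟩
  obtain ⟨c, ⟨_, hc⟩, hcr⟩ := exists_lt_of_csInf_lt hne hmr
  set L : ℝ := max 1 (B / r)
  have hL : B ≤ L * r := (div_le_iff₀ hr0).mp (le_max_right _ _)
  have hL1 : 1 ≤ L := le_max_left _ _
  refine ⟨r, L ^ (m : ℕ), hr0, hrρ, by positivity, fun n => ?_⟩
  induction n using Nat.strong_induction_on with
  | _ n ih =>
    intro x
    rcases lt_or_ge n (m : ℕ) with hn | hn
    · calc ‖(u ^ n) x‖ ≤ B ^ n * ‖x‖ := norm_pow_apply_le hB hu n x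
        _ ≤ (L * r) ^ n * ‖x‖ := by gcongr
        _ = L ^ n * r ^ n * ‖x‖ := by rw [mul_pow]
        _ ≤ L ^ (m : ℕ) * r ^ n * ‖x‖ := by gcongr
    · obtain ⟨d, rfl⟩ := Nat.exists_eq_add_of_le hn
      rw [pow_add, Module.End.mul_apply]
      calc _ ≤ c * ‖(u ^ d) x‖ := hc _
        _ ≤ r ^ (m : ℕ) * (L ^ (m : ℕ) * r ^ d * ‖x‖) := by
          gcongr
          exact ih d (by have := m.pos; omega) x
        _ = _ := by rw [pow_add]; ring

end Spectral

/-! ### The binomial functions on the disc -/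

namespace Disc

variable {k : Type*} [NormedField k] [IsUltrametricDist k]

theorem norm_natCast_le_one (n : ℕ) : ‖(n : Disc k)‖ ≤ 1 := by
  rw [← map_natCast (algebraMap k (Disc k)), Algebra.algebraMap_eq_smul_one]
  exact (norm_smul_le _ _).trans
    (mul_le_one₀ (Berk.norm_natCast_le_one k n) (norm_nonneg _) norm_one_le)

theorem norm_descPochhammer_le (n : ℕ) :
    ‖Polynomial.aeval (T k) (descPochhammer k n)‖ ≤ 1 := by
  induction n with
  | zero => rw [descPochhammer_zero, map_one]; exact norm_one_le
  | succ n ih =>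
    rw [descPochhammer_succ_right, map_mul, map_sub, Polynomial.aeval_X, map_natCast]
    refine (norm_mul_le _ _).trans (mul_le_one₀ ih (norm_nonneg _) ?_)
    rw [sub_eq_add_neg]
    refine (IsUltrametricDist.norm_add_le_max _ _).trans (max_le norm_T_le ?_)
    rw [norm_neg]
    exact norm_natCast_le_one n

/-- The function `T (T - 1) ⋯ (T - n + 1) / n!` on the disc. -/
def binom (k : Type*) [NormedField k] [IsUltrametricDist k] (n : ℕ) : Disc k :=
  (n.factorial : k)⁻¹ • Polynomial.aeval (T k) (descPochhammer k n)

theorem norm_binom_le [CharZero k] (n : ℕ) : ‖binom k n‖ ≤ (R k ^ n)⁻¹ := by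
  have hR := R_pos k
  refine (norm_smul_le _ _).trans ?_
  rw [norm_inv]
  calc _ ≤ (R k ^ n)⁻¹ * 1 := by
        gcongr <;> [exact R_pow_le_norm_factorial k n; exact norm_descPochhammer_le n]
    _ = _ := mul_one _

theorem point_binom [CharZero k] [CompleteSpace k] (m n : ℕ) (hm : ‖(m : k)‖ ≤ 1) :
    point (m : k) hm (binom k n) = (m.choose n : k) := by
  have h : (point (m : k) hm) (Polynomial.aeval (T k) (descPochhammer k n)) =
      Polynomial.aeval (m : k) (descPochhammer k n) := by
    rw [← Polynomial.aeval_algHom_apply]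
    congr 2
    exact eval_T _ hm
  rw [binom, map_smul, h, Polynomial.coe_aeval_eq_eval, descPochhammer_eval_eq_descFactorial,
    smul_eq_mul, Nat.descFactorial_eq_factorial_mul_choose, Nat.cast_mul,
    inv_mul_cancel_left₀ (Nat.cast_ne_zero.mpr (Nat.factorial_ne_zero n))]

end Disc

/-! ### The action interpolating the iterates -/

section Flow

variable {k A : Type*} [NormedField k] [NormedCommRing A] [NormedAlgebra k A]

theorem exists_norm_diffOp_apply_le (f : BddHom k A A) :
    ∃ B : ℝ, 0 ≤ B ∧ ∀ x, ‖diffOp f x‖ ≤ B * ‖x‖ := by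
  obtain ⟨B, hB, h⟩ := f.bounded
  refine ⟨B + 1, by positivity, fun x => ?_⟩
  calc ‖f x - x‖ ≤ ‖f x‖ + ‖x‖ := norm_sub_le _ _
    _ ≤ B * ‖x‖ + ‖x‖ := by gcongr; exact h x
    _ = _ := by ring

/-- Newton's formula `fᵐ = ∑ (m choose n) Δⁿ`. -/
theorem iterate_eq_sum_diffOp (f : BddHom k A A) (m : ℕ) (a : A) :
    (⇑f)^[m] a = ∑ n ∈ Finset.range (m + 1), (m.choose n : k) • (diffOp f ^ n) a := by
  have h1 : (⇑f)^[m] a = ((diffOp f + 1) ^ m) a := by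
    rw [Module.End.pow_apply]
    have h : ⇑f = ⇑(diffOp f + 1) := funext fun x => (sub_add_cancel (f x) x).symm
    rw [h]
  rw [h1, (Commute.one_right (diffOp f)).add_pow, LinearMap.sum_apply]
  refine Finset.sum_congr rfl fun n _ => ?_
  rw [one_pow, mul_one, ← (Nat.cast_commute (m.choose n) (diffOp f ^ n)).eq, Module.End.mul_apply,
    Module.End.natCast_apply, Nat.cast_smul_eq_nsmul]

theorem iterate_map_algebraMap (f : BddHom k A A) (m : ℕ) (t : k) :
    (⇑f)^[m] (algebraMap k A t) = algebraMap k A t :=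
  Function.iterate_fixed (AlgHomClass.commutes f t) m

variable [IsUltrametricDist k]

/-- The `n`-th term of the binomial series `∑ binom(T, n) ⊗ Δⁿ a`. -/
def flowTerm (f : BddHom k A A) (a : A) (n : ℕ) : CTensor k (Disc k) A :=
  CTensor.fst k (Disc k) A (Disc.binom k n) * CTensor.snd k (Disc k) A ((diffOp f ^ n) a)

variable [CharZero k]

/-- Since `‖binom(T, n)‖ ≤ R(k)⁻ⁿ`, the binomial series is dominated by a geometric series. -/
theorem exists_norm_flowTerm_le (f : BddHom k A A) (hf : spectralRadius (diffOp f) < R k) :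
    ∃ q C : ℝ, 0 ≤ q ∧ q < 1 ∧ 0 ≤ C ∧ ∀ a n, ‖flowTerm f a n‖ ≤ C * ‖a‖ * q ^ n := by
  obtain ⟨B, hB, hu⟩ := exists_norm_diffOp_apply_le f
  obtain ⟨r, C, hr, hrR, hC, h⟩ := exists_norm_pow_le_of_spectralRadius_lt hB hu hf
  have hR := R_pos k
  refine ⟨r / R k, C, by positivity, (div_lt_one hR).mpr hrR, hC, fun a n => ?_⟩
  calc ‖flowTerm f a n‖ ≤ ‖Disc.binom k n‖ * ‖(diffOp f ^ n) a‖ := CTensor.norm_fst_mul_snd_le _ _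
    _ ≤ (R k ^ n)⁻¹ * (C * r ^ n * ‖a‖) := by
      gcongr <;> [exact Disc.norm_binom_le n; exact h n a]
    _ = C * ‖a‖ * (r / R k) ^ n := by rw [div_pow]; ring

theorem summable_flowTerm (f : BddHom k A A) (hf : spectralRadius (diffOp f) < R k) (a : A) :
    Summable (flowTerm f a) := by
  obtain ⟨q, C, hq, hq1, _, h⟩ := exists_norm_flowTerm_le f hf
  exact .of_norm_bounded ((summable_geometric_of_lt_one hq hq1).mul_left _) (h a)

variable [CompleteSpace k] [IsUltrametricDist A] [CompleteSpace A]

theorem evalAt_tsum_flowTerm (f : BddHom k A A) (hf : spectralRadius (diffOp f) < R k) (a : A)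
    (m : ℕ) : evalAt A (m : k) (norm_natCast_le_one k m) (∑' n, flowTerm f a n) =
      (⇑f)^[m] a := by
  have h : ∀ n, evalAt A (m : k) (norm_natCast_le_one k m) (flowTerm f a n) =
      (m.choose n : k) • (diffOp f ^ n) a := fun n => by
    rw [flowTerm, map_mul, evalAt_fst, evalAt_snd, Disc.point_binom, Algebra.smul_def]
  rw [(summable_flowTerm f hf a).map_tsum _ (evalAt A (m : k) _).continuous,
    iterate_eq_sum_diffOp (k := k) f m a]
  simp only [h]
  refine tsum_eq_sum fun n hn => ?_
  rw [Nat.choose_eq_zero_of_lt (by simpa [Nat.lt_succ_iff] using hn), Nat.cast_zero, zero_smul]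

/-- The morphism `𝔻 × M(A) → M(A)` given by the binomial series
`a ↦ ∑ binom(T, n) ⊗ Δⁿ a = (1 + Δ)ᵀ a`. It is a homomorphism by the identity principle, as the
iterates of `f` are. -/
def flow (f : BddHom k A A) (hf : spectralRadius (diffOp f) < R k) :
    BddHom k A (CTensor k (Disc k) A) where
  toFun a := ∑' n, flowTerm f a n
  map_one' := eq_of_evalAt fun m => by
    rw [evalAt_tsum_flowTerm f hf, map_one, iterate_map_one]
  map_mul' a b := eq_of_evalAt fun m => by
    rw [map_mul]
    simp only [evalAt_tsum_flowTerm f hf, iterate_map_mul]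
  map_zero' := eq_of_evalAt fun m => by
    rw [evalAt_tsum_flowTerm f hf, map_zero, iterate_map_zero]
  map_add' a b := eq_of_evalAt fun m => by
    rw [map_add]
    simp only [evalAt_tsum_flowTerm f hf, iterate_map_add]
  commutes' t := eq_of_evalAt fun m => by
    rw [evalAt_tsum_flowTerm f hf, AlgHomClass.commutes, iterate_map_algebraMap]
  bounded' := by
    obtain ⟨q, C, hq, hq1, hC, h⟩ := exists_norm_flowTerm_le f hf
    refine ⟨C, fun a => ?_⟩
    refine IsUltrametricDist.norm_tsum_le_of_forall_le_of_nonneg (by positivity) fun n => ?_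
    exact (h a n).trans (mul_le_of_le_one_right (by positivity) (pow_le_one₀ hq hq1.le))

theorem slice_flow (f : BddHom k A A) (hf : spectralRadius (diffOp f) < R k) (m : ℕ) (a : A) :
    slice (flow f hf) (m : k) (norm_natCast_le_one k m) a = (⇑f)^[m] a :=
  evalAt_tsum_flowTerm f hf a m

end Flow

section Action

variable {k A : Type*} [NormedField k] [IsUltrametricDist k] [CompleteSpace k]
  [NormedCommRing A] [NormedAlgebra k A] [IsUltrametricDist A] [CompleteSpace A]

/-- The fibre over `(c, d)` of `(s, t, x) ↦ Φ(s + t, x)` is `x ↦ Φ(c + d, x)`. -/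
theorem evalAt_evalAt_add (Φ : BddHom k A (CTensor k (Disc k) A)) {c d : k} (hc : ‖c‖ ≤ 1)
    (hd : ‖d‖ ≤ 1) (a : A) :
    evalAt A d hd (evalAt (CTensor k (Disc k) A) c hc
      ((CTensor.lift ((CTensor.lift (CTensor.fst k (Disc k) (CTensor k (Disc k) A))
        ((CTensor.snd k (Disc k) (CTensor k (Disc k) A)).comp (CTensor.fst k (Disc k) A))).comp
          (Disc.add k))
        ((CTensor.snd k (Disc k) (CTensor k (Disc k) A)).comp (CTensor.snd k (Disc k) A))) (Φ a))) =
      slice Φ (c + d) ((IsUltrametricDist.norm_add_le_max c d).trans (max_le hc hd)) a := by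
  set L := CTensor.lift ((CTensor.lift (CTensor.fst k (Disc k) (CTensor k (Disc k) A))
        ((CTensor.snd k (Disc k) (CTensor k (Disc k) A)).comp (CTensor.fst k (Disc k) A))).comp
          (Disc.add k))
        ((CTensor.snd k (Disc k) (CTensor k (Disc k) A)).comp (CTensor.snd k (Disc k) A)) with hL
  have h : ((evalAt A d hd).comp (evalAt (CTensor k (Disc k) A) c hc)).comp L =
      evalAt A (c + d) ((IsUltrametricDist.norm_add_le_max c d).trans (max_le hc hd)) := by
    refine CTensor.hom_ext (fun g => ?_) fun b => ?_
    · have hg : (((evalAt A d hd).comp (evalAt (CTensor k (Disc k) A) c hc)).comp L).comp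
          (CTensor.fst k (Disc k) A) =
          (evalAt A (c + d) ((IsUltrametricDist.norm_add_le_max c d).trans (max_le hc hd))).comp
            (CTensor.fst k (Disc k) A) := by
        refine Disc.hom_ext ?_
        simp only [BddHom.comp_apply, hL, CTensor.lift_fst, Disc.add, Disc.eval_T, map_add,
          CTensor.lift_snd, evalAt_fst, evalAt_snd, Disc.point, AlgHomClass.commutes]
      exact DFunLike.congr_fun hg g
    · simp only [BddHom.comp_apply, hL, CTensor.lift_snd, evalAt_snd]
  exact DFunLike.congr_fun h (Φ a)

/-- The fibre over `(c, d)` of `(s, t, x) ↦ Φ(s, Φ(t, x))` is `x ↦ Φ(c, Φ(d, x))`. -/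
theorem evalAt_evalAt_comp (Φ : BddHom k A (CTensor k (Disc k) A)) {c d : k} (hc : ‖c‖ ≤ 1)
    (hd : ‖d‖ ≤ 1) (a : A) :
    evalAt A d hd (evalAt (CTensor k (Disc k) A) c hc
      ((CTensor.lift (CTensor.fst k (Disc k) (CTensor k (Disc k) A))
        ((CTensor.lift
          ((CTensor.snd k (Disc k) (CTensor k (Disc k) A)).comp (CTensor.fst k (Disc k) A))
          ((CTensor.snd k (Disc k) (CTensor k (Disc k) A)).comp (CTensor.snd k (Disc k) A))).comp
            Φ)) (Φ a))) =
      slice Φ d hd (slice Φ c hc a) := by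
  set s := CTensor.fst k (Disc k) (CTensor k (Disc k) A)
  set w := CTensor.snd k (Disc k) (CTensor k (Disc k) A)
  have hw : CTensor.lift (w.comp (CTensor.fst k (Disc k) A)) (w.comp (CTensor.snd k (Disc k) A)) =
      w :=
    CTensor.hom_ext (fun g => CTensor.lift_fst _ _ g) fun b => CTensor.lift_snd _ _ b
  rw [hw]
  have h : ((evalAt A d hd).comp (evalAt (CTensor k (Disc k) A) c hc)).comp
      (CTensor.lift s (w.comp Φ)) = (slice Φ d hd).comp (evalAt A c hc) := by
    refine CTensor.hom_ext (fun g => ?_) fun b => ?_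
    · simp only [BddHom.comp_apply, CTensor.lift_fst, s, evalAt_fst, AlgHomClass.commutes]
    · simp only [BddHom.comp_apply, CTensor.lift_snd, w, evalAt_snd]
      rfl
  exact DFunLike.congr_fun h (Φ a)

/-- A morphism which restricts to the iterates of `f` over the natural numbers is an action: by the
identity principle in both variables of the disc, it suffices that `fᵐ⁺ⁿ = fᵐ ∘ fⁿ`. -/
theorem isDiscAction_of_slice_eq_iterate [CharZero k] {Φ : BddHom k A (CTensor k (Disc k) A)}
    {f : BddHom k A A}
    (h : ∀ (n : ℕ) (a : A), slice Φ (n : k) (norm_natCast_le_one k n) a = (⇑f)^[n] a) :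
    IsDiscAction Φ where
  zero_act := by
    refine BddHom.ext fun a => ?_
    have := h 0 a
    simp only [Nat.cast_zero] at this
    exact this
  add_act := by
    refine BddHom.ext fun a => eq_of_evalAt fun m => eq_of_evalAt fun n => ?_
    refine (evalAt_evalAt_add Φ _ _ a).trans (Eq.trans ?_ (evalAt_evalAt_comp Φ _ _ a).symm)
    have hmn := h (m + n) a
    simp only [Nat.cast_add] at hmn
    rw [hmn, h, h, Nat.add_comm, Function.iterate_add_apply]

end Action

end Berk

end

theorem theorem8 {k A : Type*}
    [NormedField k] [IsUltrametricDist k] [CompleteSpace k] [CharZero k]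
    [NormedCommRing A] [NormedAlgebra k A] [IsUltrametricDist A] [CompleteSpace A]
    (hA : Berk.IsAffinoid k A) (f : Berk.BddHom k A A)
    (hf : Berk.spectralRadius (Berk.diffOp f) < Berk.R k) :
    ∃! Φ : Berk.BddHom k A (Berk.CTensor k (Berk.Disc k) A),
      Berk.IsDiscAction Φ ∧
      ∀ (n : ℕ) (h : A),
        Berk.slice Φ (n : k) (Berk.norm_natCast_le_one k n) h = (⇑f)^[n] h := by
  have hflow := Berk.slice_flow f hf
  refine ⟨Berk.flow f hf, ⟨Berk.isDiscAction_of_slice_eq_iterate hflow, hflow⟩, ?_⟩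
  rintro Ψ ⟨-, hΨ⟩
  exact Berk.BddHom.ext fun a =>
    Berk.eq_of_evalAt fun n => (hΨ n a).trans (hflow n a).symm
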